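/- Let $H^2$ be the Hardy space of all $\psi\in L^2([0,2\pi))$ (with the norm $\|\psi\|^2=(2\pi)^{-1}\int_0^{2\pi}|\psi(\theta)|^2\,d\theta$) whose Fourier series has the form $\psi(\theta)=\sum_{n=0}^\infty d_n e^{-in\theta}$; functions on $[0,2\pi)$ are extended $2\pi$-periodically. A \emph{(covariant) phase observable} is a map $(\psi,\varphi)\mapsto f_{\psi,\varphi}$ from pairs of unit vectors of $H^2$ to complex functions on $[0,2\pi)$ such that, with all equalities and inequalities between functions holding for almost every $\theta$: 1. for every unit vector $\psi\in H^2$, $f_{\psi,\psi}$ is integrable, $f_{\psi,\psi}\ge 0$, and $(2\pi)^{-1}\int_0^{2\pi}f_{\psi,\psi}(\theta)\,d\theta=1$; 2. for all unit vectors $\psi,\varphi\in H^2$ and all $c_1,c_2\in\mathbb C$ with $\|c_1\psi+c_2\varphi\|=1$, $$f_{c_1\psi+c_2\varphi,\,c_1\psi+c_2\varphi}=|c_1|^2f_{\psi,\psi}+|c_2|^2f_{\varphi,\varphi}+\overline{c_1}c_2f_{\psi,\varphi}+c_1\overline{c_2}f_{\varphi,\psi};$$ 3. for every unit vector $\psi\in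 H^2$ and every $\alpha\in\mathbb R$, $f_{\psi^\alpha,\psi^\alpha}(\theta)=f_{\psi,\psi}(\theta+\alpha)$, where $\psi^\alpha(\theta)=\psi(\theta+\alpha)$. Let $(\psi,\varphi)\mapsto f_{\psi,\varphi}$ be a phase observable. Then: (a) (Nonlocalizability.) For every Borel set $X\subseteq[0,2\pi)$ of Lebesgue measure strictly less than $2\pi$ and every unit vector $\psi\in H^2$, $$\frac1{2\pi}\int_X f_{\psi,\psi}(\theta)\,d\theta<1 .$$ (b) The phase observable, with outcome probabilities $p_\psi(X)=(2\pi)^{-1}\int_X f_{\psi,\psi}(\theta)\,d\theta$ for Borel sets $X\subseteq[0,2\pi)$, and the number observable, with outcome probabilities $q_\psi(S)=\sum_{n\in S}|d_n|^2$ for $S\subseteq\mathbb N=\{0,1,2,\dots\}$ and $\psi=\sum_n d_ne^{-in\theta}$, are probabilistically complementary. That is, whenever $X$ and $S$ are such that neither $\psi\mapsto p_\psi(X)$ nor $\psi\mapsto q_\psi(S)$ is identically $0$ or identically $1$ on the unit vectors, then for every unit vector $\psi$: $p_\psi(X)=1$ implies $0<q_\psi(S)<1$, and $q_\psi(S)=1$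 implies $0<p_\psi(X)<1$. -/

import Mathlib

open MeasureTheory Set
open scoped Real

noncomputable section

instance factZeroLtTwoPi : Fact (0 < 2 * π) := ⟨by positivity⟩

/-- The phase circle `ℝ / 2πℤ`: a function on it is a `2π`-periodic function of a real variable,
i.e. the periodic extension of a function on `[0, 2π)`. Its default measure `volume` is
Lebesgue measure (total mass `2π`). -/
abbrev PhaseCircle : Type := AddCircle (2 * π)

/-- `L²([0, 2π))` with the normalized inner product `(2π)⁻¹ ∫ conj ψ(θ) φ(θ) dθ`. -/
abbrev PhaseL2 : Type := Lp ℂ 2 (AddCircle.haarAddCircle (T := 2 * π))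

/-- The Hardy space `H²`: those `ψ` in `L²([0, 2π))` whose Fourier series has the form
`∑_{n ≥ 0} d_n e^{-inθ}`. -/
def Hardy : Submodule ℂ PhaseL2 where
  carrier := {ψ | ∀ n : ℤ, 0 < n → fourierCoeff (ψ : PhaseCircle → ℂ) n = 0}
  add_mem' := by
    intro a b ha hb n hn
    have h1 := ha n hn
    have h2 := hb n hn
    rw [← fourierBasis_repr] at h1 h2 ⊢
    simp [h1, h2]
  zero_mem' := by
    intro n _
    rw [← fourierBasis_repr]
    simp
  smul_mem' := by
    intro c a ha n hn
    have h1 := ha n hn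
    rw [← fourierBasis_repr] at h1 ⊢
    simp [h1]

/-- The phase shift `ψ(θ) ↦ ψ(θ + α)` on `L²([0, 2π))`. -/
def shiftL2 (α : ℝ) (ψ : PhaseL2) : PhaseL2 :=
  Lp.compMeasurePreserving (fun θ : PhaseCircle => θ + (α : PhaseCircle))
    (measurePreserving_add_right _ _) ψ

theorem shiftL2_ae (α : ℝ) (ψ : PhaseL2) :
    (shiftL2 α ψ : PhaseCircle → ℂ) =ᵐ[AddCircle.haarAddCircle]
      fun θ => (ψ : PhaseCircle → ℂ) (θ + (α : PhaseCircle)) :=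
  Lp.coeFn_compMeasurePreserving ψ (measurePreserving_add_right _ _)

theorem shiftL2_mem_hardy (α : ℝ) {ψ : PhaseL2} (hψ : ψ ∈ Hardy) : shiftL2 α ψ ∈ Hardy := by
  intro n hn
  have h0 := hψ n hn
  unfold fourierCoeff at h0 ⊢
  rw [integral_congr_ae (g := fun θ : PhaseCircle => fourier n (α : PhaseCircle) *
    (fun t : PhaseCircle => fourier (-n) t • (ψ : PhaseCircle → ℂ) t) (θ + (α : PhaseCircle)))]
  · rw [integral_const_mul, integral_add_right_eq_self
      (fun t : PhaseCircle => fourier (-n) t • (ψ : PhaseCircle → ℂ) t), h0, mul_zero]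
  · filter_upwards [shiftL2_ae α ψ] with θ hθ
    have h1 : (fourier n (α : PhaseCircle) : ℂ) * fourier (-n) (α : PhaseCircle) = 1 := by
      rw [← fourier_add]; simp
    have h2 : (fourier (-n) (θ + (α : PhaseCircle)) : ℂ)
        = fourier (-n) θ * fourier (-n) (α : PhaseCircle) := by
      simp [fourier_apply, smul_add, AddCircle.toCircle_add]
    simp only [smul_eq_mul]
    rw [hθ, h2]
    linear_combination (-(fourier (-n) θ : ℂ)
      * (ψ : PhaseCircle → ℂ) (θ + (α : PhaseCircle))) * h1

/-- The phase shifted wave function `ψ^α(θ) = ψ(θ + α)` in `H²`. -/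
def phaseShift (α : ℝ) (ψ : Hardy) : Hardy := ⟨shiftL2 α ψ, shiftL2_mem_hardy α ψ.2⟩

/-- A phase observable: a map `(ψ, φ) ↦ f_{ψ,φ}` from pairs of unit vectors of `H²` to functions
on the phase circle (identified when they agree almost everywhere) such that every `f_{ψ,ψ}` is a
probability density, interference effects exist, and phase shift covariance holds.
Only the values of `f` at pairs of unit vectors matter. -/
structure IsPhaseObservable (f : Hardy → Hardy → PhaseCircle → ℂ) : Prop where
  /-- `f_{ψ,ψ}` is integrable. -/
  integrable : ∀ ψ : Hardy, ‖ψ‖ = 1 → Integrable (f ψ ψ) volume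
  /-- `f_{ψ,ψ}` is real and nonnegative. -/
  nonneg : ∀ ψ : Hardy, ‖ψ‖ = 1 →
    ∀ᵐ θ : PhaseCircle ∂volume, (f ψ ψ θ).im = 0 ∧ 0 ≤ (f ψ ψ θ).re
  /-- `f_{ψ,ψ}` is normalized. -/
  normalized : ∀ ψ : Hardy, ‖ψ‖ = 1 → (2 * π)⁻¹ * ∫ θ : PhaseCircle, (f ψ ψ θ).re = 1
  /-- Existence of interference effects. -/
  interference : ∀ ψ φ : Hardy, ‖ψ‖ = 1 → ‖φ‖ = 1 → ∀ c₁ c₂ : ℂ, ‖c₁ • ψ + c₂ • φ‖ = 1 →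
    ∀ᵐ θ : PhaseCircle ∂volume,
      f (c₁ • ψ + c₂ • φ) (c₁ • ψ + c₂ • φ) θ =
        (‖c₁‖ : ℂ) ^ 2 * f ψ ψ θ + (‖c₂‖ : ℂ) ^ 2 * f φ φ θ
          + star c₁ * c₂ * f ψ φ θ + c₁ * star c₂ * f φ ψ θ
  /-- Phase shift covariance. -/
  covariant : ∀ ψ : Hardy, ‖ψ‖ = 1 → ∀ α : ℝ, ∀ᵐ θ : PhaseCircle ∂volume,
    f (phaseShift α ψ) (phaseShift α ψ) θ = f ψ ψ (θ + (α : PhaseCircle))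

/-- Outcome probabilities of a phase observable in the state `ψ`, as a measure on the Borel sets
of the real line concentrated on `[0, 2π)`. -/
def phaseProb (f : Hardy → Hardy → PhaseCircle → ℂ) (ψ : Hardy) (X : Set ℝ) : ℝ :=
  (2 * π)⁻¹ * ∫ θ in X ∩ Ico 0 (2 * π), (f ψ ψ (θ : PhaseCircle)).re

/-- Outcome probabilities of the number observable in the state `ψ = ∑ d_n e^{-inθ}`:
the value lies in `S` with probability `∑_{n ∈ S} |d_n|²`. -/
def numberProb (ψ : Hardy) (S : Set ℕ) : ℝ :=
  ∑' n : ℕ, S.indicator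
    (fun n => ‖fourierCoeff ((ψ : PhaseL2) : PhaseCircle → ℂ) (-(n : ℤ))‖ ^ 2) n

/-- The effect belonging to the outcome set `X` is neither `0` nor the identity. The function `p`
gives the outcome probabilities `p ψ X = ⟨ψ, E(X) ψ⟩` of an observable `E`. -/
def NontrivialEffect {H Ω : Type*} [Norm H] (p : H → Set Ω → ℝ) (X : Set Ω) : Prop :=
  (∃ ψ : H, ‖ψ‖ = 1 ∧ p ψ X ≠ 0) ∧ (∃ ψ : H, ‖ψ‖ = 1 ∧ p ψ X ≠ 1)

/-- Probabilistic complementarity of two observables, given by their outcome probabilities in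
vector states: if a nontrivial effect of one of them is certain in some state, then every
nontrivial effect of the other one has probability strictly between `0` and `1` in that state. -/
def ProbabilisticallyComplementary {H Ω₁ Ω₂ : Type*} [Norm H] [MeasurableSpace Ω₁]
    [MeasurableSpace Ω₂] (p₁ : H → Set Ω₁ → ℝ) (p₂ : H → Set Ω₂ → ℝ) : Prop :=
  ∀ (X : Set Ω₁) (Y : Set Ω₂), MeasurableSet X → MeasurableSet Y →
    NontrivialEffect p₁ X → NontrivialEffect p₂ Y → ∀ ψ : H, ‖ψ‖ = 1 →
      (p₁ ψ X = 1 → 0 < p₂ ψ Y ∧ p₂ ψ Y < 1) ∧ (p₂ ψ Y = 1 → 0 < p₁ ψ X ∧ p₁ ψ X < 1)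

end

/-! Everything follows from one fact: for every unit vector `a` the density `f a a` is almost
everywhere positive. Then every set of positive measure has positive probability, every set missing
positive measure has probability below one, and a nontrivial phase effect is never certain and never
impossible.

To prove positivity, extend the densities quadratically to an `L¹`-valued map on `H²`
(`isRealQuadratic_density`) and polarize it to a form, continuous in its second argument
(`continuous_form`). Covariance and ergodicity of an irrational rotation show that the form of the
number states `n`, `m` is a multiple of `e^{i(n-m)θ}` (`exists_form_numberState`). If `n` is the
lowest number occurring in `a`, the interference term of the number state `n` with `a` is therefore
an `L¹` limit of polynomials in `e^{-iθ}` with a fixed nonzero constant term. Jensen's inequality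
forbids such a limit to vanish on a set of positive measure (`ae_ne_zero_of_tendsto_polynomial`).
Positivity of the densities makes the interference term vanish wherever the density of `a` does
(`form_density_eq_zero`), so that density is almost everywhere nonzero. -/

/-! ### Jensen's inequality and zero sets of `L¹` limits of polynomials -/

open Polynomial in
/-- Jensen's inequality for polynomials on the phase circle. -/
theorem log_norm_coeff_zero_le (p : ℂ[X]) (hp : p.coeff 0 ≠ 0) :
    Integrable (fun θ : PhaseCircle => Real.log ‖p.eval (θ.toCircle : ℂ)‖) volume ∧
    2 * π * Real.log ‖p.coeff 0‖ ≤
      ∫ θ : PhaseCircle, Real.log ‖p.eval (θ.toCircle : ℂ)‖ := by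
  have hcirc : ∀ x : ℝ, (AddCircle.toCircle (x : PhaseCircle) : ℂ) = circleMap 0 1 x := by
    intro x
    rw [AddCircle.toCircle_apply_mk]
    simp [circleMap, Circle.coe_exp]
  have hint : IntegrableOn (fun x : ℝ => Real.log ‖p.eval (AddCircle.toCircle (x : PhaseCircle) : ℂ)‖)
      (Ioc 0 (0 + 2 * π)) := by
    have h := p.intervalIntegrable_mahlerMeasure
    rw [intervalIntegrable_iff_integrableOn_Ioc_of_le (by positivity)] at h
    simpa [hcirc] using h
  refine ⟨?_, ?_⟩
  · have hmp := AddCircle.measurePreserving_mk (2 * π) 0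
    refine (hmp.integrable_comp ?_).1 hint
    refine Measurable.aestronglyMeasurable ?_
    refine Real.measurable_log.comp (Continuous.measurable ?_)
    fun_prop
  · have h := Polynomial.norm_coeff_le_choose_mul_mahlerMeasure 0 p
    simp only [Nat.choose_zero_right, Nat.cast_one, one_mul] at h
    have h1 := Real.log_le_log (norm_pos_iff.2 hp) h
    rw [← p.logMahlerMeasure_eq_log_MahlerMeasure, p.logMahlerMeasure_def,
      Real.circleAverage_def] at h1
    rw [← AddCircle.intervalIntegral_preimage (2 * π) 0]
    simp only [hcirc, zero_add]
    rw [smul_eq_mul] at h1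
    have hpi := Real.two_pi_pos
    calc 2 * π * Real.log ‖p.coeff 0‖ ≤ 2 * π * _ := mul_le_mul_of_nonneg_left h1 hpi.le
      _ = _ := by field_simp

theorem integrable_log_norm_add {α : Type*} [MeasurableSpace α] {μ : Measure α} [IsFiniteMeasure μ]
    {h : α → ℂ} (hi : Integrable h μ) {ε : ℝ} (hε : 0 < ε) :
    Integrable (fun θ => Real.log (‖h θ‖ + ε)) μ := by
  refine Integrable.mono' (hi.norm.add (integrable_const (ε + |Real.log ε|))) ?_ ?_
  · exact (Real.measurable_log.comp_aemeasurable
      (hi.norm.aestronglyMeasurable.aemeasurable.add_const ε)).aestronglyMeasurable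
  · refine Filter.Eventually.of_forall fun θ => ?_
    have h0 := norm_nonneg (h θ)
    have h1 : Real.log ε ≤ Real.log (‖h θ‖ + ε) := Real.log_le_log hε (by linarith)
    have h2 := Real.log_le_sub_one_of_pos (show 0 < ‖h θ‖ + ε by linarith)
    have h3 := neg_abs_le (Real.log ε)
    simp only [Pi.add_apply, Real.norm_eq_abs]
    rw [abs_le]
    constructor <;> linarith [abs_nonneg (Real.log ε)]

-- The shift by `ε` tames the logarithm, so that the bound survives `L¹` limits.
open Polynomial in
theorem log_norm_coeff_zero_le_add (p : ℂ[X]) (hp : p.coeff 0 ≠ 0) {ε : ℝ} (hε : 0 < ε) :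
    2 * π * Real.log ‖p.coeff 0‖ ≤
      ∫ θ : PhaseCircle, Real.log (‖p.eval (θ.toCircle : ℂ)‖ + ε) := by
  have hp0 : p ≠ 0 := by rintro rfl; simp at hp
  obtain ⟨h1, h2⟩ := log_norm_coeff_zero_le p hp
  have hpi : Integrable (fun θ : PhaseCircle => p.eval (θ.toCircle : ℂ)) volume :=
    Continuous.integrable_of_hasCompactSupport (by fun_prop) (HasCompactSupport.of_compactSpace _)
  refine h2.trans (integral_mono_ae h1 (integrable_log_norm_add hpi hε) ?_)
  -- Zeros must be discarded: there `Real.log 0 = 0`, which exceeds `log ε` when `ε < 1`.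
  have hfin : {θ : PhaseCircle | p.eval (θ.toCircle : ℂ) = 0}.Finite := by
    refine Set.Finite.of_finite_image (f := fun θ : PhaseCircle => (θ.toCircle : ℂ))
      ((p.roots.toFinset.finite_toSet).subset ?_) ?_
    · rintro _ ⟨θ, hθ, rfl⟩
      simpa [hp0] using hθ
    · intro a _ b _ hab
      exact AddCircle.injective_toCircle (by positivity) (Subtype.ext hab)
  have hz : ∀ᵐ θ : PhaseCircle, p.eval (θ.toCircle : ℂ) ≠ 0 := by
    rw [ae_iff]
    simp only [ne_eq, not_not]
    rw [← Set.biUnion_of_singleton {θ : PhaseCircle | p.eval (θ.toCircle : ℂ) = 0},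
      measure_biUnion_null_iff hfin.countable]
    intro x _
    rw [← Metric.closedBall_zero, AddCircle.volume_closedBall]
    simp [Real.pi_pos.le]
  filter_upwards [hz] with θ hθ
  exact Real.log_le_log (norm_pos_iff.2 hθ) (by linarith)

open Polynomial Filter Topology in
/-- An `L¹` limit of polynomials in `e^{iθ}` with a fixed nonzero constant coefficient is almost
everywhere nonzero. -/
theorem ae_ne_zero_of_tendsto_polynomial {h : PhaseCircle → ℂ} (hi : Integrable h volume)
    (p : ℕ → ℂ[X]) {c : ℂ} (hc : c ≠ 0) (hpc : ∀ N, (p N).coeff 0 = c)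
    (hlim : Tendsto (fun N => ∫ θ : PhaseCircle, ‖(p N).eval (θ.toCircle : ℂ) - h θ‖)
      atTop (𝓝 0)) : ∀ᵐ θ : PhaseCircle, h θ ≠ 0 := by
  -- Since `log x ≤ x - 1`, replacing the polynomial by `h` costs at most `ε⁻¹` times their `L¹`
  -- distance, which tends to zero.
  have key : ∀ ε : ℝ, 0 < ε → 2 * π * Real.log ‖c‖ ≤ ∫ θ : PhaseCircle, Real.log (‖h θ‖ + ε) := by
    intro ε hε
    have hle : ∀ N, 2 * π * Real.log ‖c‖ ≤ (∫ θ : PhaseCircle, Real.log (‖h θ‖ + ε)) +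
        ε⁻¹ * ∫ θ : PhaseCircle, ‖(p N).eval (θ.toCircle : ℂ) - h θ‖ := by
      intro N
      have hpi : Integrable (fun θ : PhaseCircle => (p N).eval (θ.toCircle : ℂ)) volume :=
        Continuous.integrable_of_hasCompactSupport (by fun_prop)
          (HasCompactSupport.of_compactSpace _)
      have hd : Integrable (fun θ : PhaseCircle => ε⁻¹ * ‖(p N).eval (θ.toCircle : ℂ) - h θ‖)
          volume := ((hpi.sub hi).norm).const_mul ε⁻¹
      have h0 := log_norm_coeff_zero_le_add (p N) (by rw [hpc]; exact hc) hε
      rw [hpc] at h0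
      refine h0.trans ?_
      rw [← integral_const_mul, ← integral_add (integrable_log_norm_add hi hε) hd]
      refine integral_mono (integrable_log_norm_add hpi hε)
        ((integrable_log_norm_add hi hε).add hd) fun θ => ?_
      beta_reduce
      set a := (p N).eval (θ.toCircle : ℂ)
      have ha : 0 < ‖a‖ + ε := by positivity
      have hb : 0 < ‖h θ‖ + ε := by positivity
      have h1 := Real.log_le_sub_one_of_pos (div_pos ha hb)
      rw [Real.log_div ha.ne' hb.ne'] at h1
      have h2 : (‖a‖ + ε) / (‖h θ‖ + ε) - 1 ≤ ε⁻¹ * ‖a - h θ‖ := by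
        rw [div_sub_one hb.ne', div_le_iff₀ hb]
        have h3 := norm_sub_norm_le a (h θ)
        have h4 : 0 ≤ ε⁻¹ * ‖a - h θ‖ * ‖h θ‖ := by positivity
        have h5 : ε⁻¹ * ‖a - h θ‖ * ε = ‖a - h θ‖ := by field_simp
        linarith
      linarith
    have ht := (hlim.const_mul ε⁻¹).const_add (∫ θ : PhaseCircle, Real.log (‖h θ‖ + ε))
    rw [mul_zero, add_zero] at ht
    exact ge_of_tendsto' ht hle
  have hZ : NullMeasurableSet {θ : PhaseCircle | h θ = 0} volume :=
    hi.aestronglyMeasurable.nullMeasurableSet_eq_fun aestronglyMeasurable_const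
  -- With `ε = exp (-K)` the integrand is `-K` on the zero set and at most `‖h‖` elsewhere; a zero
  -- set of positive measure is excluded by taking `K` large.
  have key2 : ∀ K : ℝ, 0 ≤ K → 2 * π * Real.log ‖c‖ ≤ (∫ θ : PhaseCircle, ‖h θ‖) -
      (volume : Measure PhaseCircle).real {θ : PhaseCircle | h θ = 0} * K := by
    intro K hK
    have hind : Integrable ({θ : PhaseCircle | h θ = 0}.indicator (fun _ => -K)) volume :=
      (integrable_const (-K)).indicator₀ hZ
    refine (key (Real.exp (-K)) (Real.exp_pos _)).trans ?_
    have he : (∫ θ : PhaseCircle, ‖h θ‖) -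
        (volume : Measure PhaseCircle).real {θ : PhaseCircle | h θ = 0} * K =
        ∫ θ : PhaseCircle, (‖h θ‖ + {θ : PhaseCircle | h θ = 0}.indicator (fun _ => -K) θ) := by
      rw [integral_add hi.norm hind, integral_indicator₀ hZ, setIntegral_const, smul_eq_mul]
      ring
    rw [he]
    refine integral_mono (integrable_log_norm_add hi (Real.exp_pos _)) (hi.norm.add hind)
      fun θ => ?_
    by_cases hθ : h θ = 0
    · simp [hθ]
    · have h1 : Real.exp (-K) ≤ 1 := Real.exp_le_one_iff.2 (by linarith)
      have h2 := Real.log_le_sub_one_of_pos (show 0 < ‖h θ‖ + Real.exp (-K) by positivity)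
      simp only [Set.indicator, Set.mem_ofPred_eq, hθ, if_false, add_zero]
      linarith
  rw [ae_iff]
  simp only [ne_eq, not_not]
  by_contra hne
  have hpos : 0 < (volume : Measure PhaseCircle).real {θ : PhaseCircle | h θ = 0} :=
    ENNReal.toReal_pos hne (measure_ne_top _ _)
  set v := (volume : Measure PhaseCircle).real {θ : PhaseCircle | h θ = 0}
  set D := (∫ θ : PhaseCircle, ‖h θ‖) - 2 * π * Real.log ‖c‖
  have h1 := key2 ((|D| + 1) / v) (by positivity)
  rw [mul_div_cancel₀ _ hpos.ne'] at h1
  have h2 := le_abs_self D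
  simp only [D] at h1 h2
  linarith

/-! ### Polarization of real quadratic maps -/

/-- A map on a complex vector space that is homogeneous of degree two and quadratic along every
real line. -/
structure IsRealQuadratic {H E : Type*} [AddCommGroup H] [Module ℂ H] [AddCommGroup E] [Module ℂ E]
    (G : H → E) : Prop where
  smul : ∀ (c : ℂ) (a : H), G (c • a) = ((‖c‖ : ℂ) ^ 2) • G a
  line : ∀ (t : ℝ) (a b : H), G (a + (t : ℂ) • b) =
    G a + ((t : ℂ) ^ 2) • G b + (t : ℂ) • QuadraticMap.polar G a b

namespace IsRealQuadratic

section Algebra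

variable {H E : Type*} [AddCommGroup H] [Module ℂ H] [AddCommGroup E] [Module ℂ E] {G : H → E}

theorem polar_smul_real (hG : IsRealQuadratic G) (t : ℝ) (a b : H) :
    QuadraticMap.polar G a ((t : ℂ) • b) = (t : ℂ) • QuadraticMap.polar G a b := by
  have h1 := hG.line t a b
  have h2 := hG.smul t b
  rw [QuadraticMap.polar, h1, h2]
  have : ((‖(t : ℂ)‖ : ℂ)) ^ 2 = (t : ℂ) ^ 2 := by
    rw [Complex.norm_real, ← Complex.ofReal_pow, Real.norm_eq_abs, sq_abs, Complex.ofReal_pow]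
  rw [this]
  module

theorem parallelogram (hG : IsRealQuadratic G) (a b : H) :
    G (a + b) + G (a - b) = (2 : ℂ) • G a + (2 : ℂ) • G b := by
  have h := hG.line (-1) a b
  have e : a + ((-1 : ℝ) : ℂ) • b = a - b := by push_cast; module
  rw [e, QuadraticMap.polar] at h
  rw [h]
  push_cast
  module

/-- The Jordan–von Neumann argument: a combination of four parallelogram identities. -/
theorem polar_add_right (hG : IsRealQuadratic G) (a b c : H) :
    QuadraticMap.polar G a (b + c) = QuadraticMap.polar G a b + QuadraticMap.polar G a c := by
  have h1 := hG.parallelogram (a + b) c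
  have h2 := hG.parallelogram (a + c) b
  have h3 := hG.parallelogram a (b - c)
  have h4 := hG.parallelogram b c
  have e1 : a + c + b = a + (b + c) := by abel
  have e2 : a + b + c = a + (b + c) := by abel
  have e3 : a + (b - c) = a + b - c := by abel
  have e4 : a - (b - c) = a + c - b := by abel
  rw [e2] at h1
  rw [e1] at h2
  rw [e3, e4] at h3
  simp only [QuadraticMap.polar]
  linear_combination (norm := module) (1 / 2 : ℂ) • h1 + (1 / 2 : ℂ) • h2 - (1 / 2 : ℂ) • h3
    - (1 / 2 : ℂ) • ((2 : ℂ) • h4)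

/-- The sesquilinear form of `G`, conjugate linear in the first argument, as a linear map in the
second one. -/
noncomputable def form (hG : IsRealQuadratic G) (a : H) : H →ₗ[ℂ] E where
  -- If `G a = s(a, a)` with `s` sesquilinear, the polar is `s(a, b) + s(b, a)`; the term with `I`
  -- cancels `s(b, a)` and doubles `s(a, b)`.
  toFun b := (1 / 2 : ℂ) • (QuadraticMap.polar G a b
    - Complex.I • QuadraticMap.polar G a (Complex.I • b))
  map_add' b c := by
    rw [smul_add, hG.polar_add_right, hG.polar_add_right]
    module
  map_smul' c b := by
    have e1 : c • b = (c.re : ℂ) • b + (c.im : ℂ) • (Complex.I • b) := by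
      conv_lhs => rw [← Complex.re_add_im c]
      module
    have e2 : Complex.I • c • b = (c.re : ℂ) • (Complex.I • b) + ((-c.im : ℝ) : ℂ) • b := by
      conv_lhs => rw [← Complex.re_add_im c]
      push_cast
      simp only [smul_smul, ← add_smul]
      congr 1
      linear_combination (c.im : ℂ) * Complex.I_mul_I
    rw [e2, e1, hG.polar_add_right, hG.polar_add_right]
    simp only [hG.polar_smul_real]
    rw [RingHom.id_apply]
    conv_rhs => rw [← Complex.re_add_im c]
    have hI := Complex.I_mul_I
    generalize QuadraticMap.polar G a b = u
    generalize QuadraticMap.polar G a (Complex.I • b) = v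
    push_cast
    match_scalars
    · ring
    · linear_combination (1 / 2 * (c.im : ℂ)) * hI

theorem form_apply (hG : IsRealQuadratic G) (a b : H) :
    hG.form a b = (1 / 2 : ℂ) • (QuadraticMap.polar G a b
      - Complex.I • QuadraticMap.polar G a (Complex.I • b)) := rfl

theorem polar_self (hG : IsRealQuadratic G) (a : H) :
    QuadraticMap.polar G a a = (2 : ℂ) • G a := by
  have h := hG.smul 2 a
  rw [two_smul] at h
  rw [QuadraticMap.polar, h, Complex.norm_ofNat]
  push_cast
  module

/-- Both `‖1 + I‖²` and `1 + ‖I‖²` equal `2`. -/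
theorem polar_self_I (hG : IsRealQuadratic G) (a : H) :
    QuadraticMap.polar G a (Complex.I • a) = 0 := by
  have h := hG.smul (1 + Complex.I) a
  have h2 := hG.smul Complex.I a
  have hn : (‖1 + Complex.I‖ : ℂ) ^ 2 = 2 := by
    rw [← Complex.ofReal_pow, Complex.sq_norm, Complex.normSq_apply]
    norm_num
  rw [add_smul, one_smul, hn] at h
  rw [QuadraticMap.polar, h, h2, Complex.norm_I]
  push_cast
  module

theorem form_self (hG : IsRealQuadratic G) (a : H) : hG.form a a = G a := by
  rw [form_apply, hG.polar_self, hG.polar_self_I]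
  module

theorem polar_smul_smul (hG : IsRealQuadratic G) {c : ℂ} (hc : ‖c‖ = 1) (a b : H) :
    QuadraticMap.polar G (c • a) (c • b) = QuadraticMap.polar G a b := by
  simp only [QuadraticMap.polar, ← smul_add, hG.smul, hc]
  simp

/-- A common phase leaves the polar unchanged, so `c` can be pulled out of both arguments.
Unimodular `c` suffices for phase shifts of number states. -/
theorem form_smul_smul (hG : IsRealQuadratic G) {c d : ℂ} (hc : ‖c‖ = 1) (a b : H) :
    hG.form (c • a) (d • b) = (star c * d) • hG.form a b := by
  have hcc : c * star c = 1 := by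
    have := Complex.mul_conj c
    rw [Complex.normSq_eq_norm_sq, hc] at this
    simpa using this
  have e : d • b = c • ((star c * d) • b) := by
    rw [smul_smul, ← mul_assoc, hcc, one_mul]
  rw [e, ← map_smul, form_apply, form_apply, smul_comm Complex.I c, hG.polar_smul_smul hc,
    hG.polar_smul_smul hc]

end Algebra

theorem continuous_form {H E : Type*} [NormedAddCommGroup H] [NormedSpace ℂ H]
    [NormedAddCommGroup E] [NormedSpace ℂ E] {G : H → E} (hG : IsRealQuadratic G) {K : ℝ}
    (hK : ∀ a, ‖G a‖ ≤ K * ‖a‖ ^ 2) (a : H) : Continuous (hG.form a) := by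
  have hpol : ∀ b : H, ‖b‖ = 1 →
      ‖QuadraticMap.polar G a b‖ ≤ |K| * (‖a‖ + 1) ^ 2 + |K| * ‖a‖ ^ 2 + |K| := by
    intro b hb
    have hK' : ∀ x, ‖G x‖ ≤ |K| * ‖x‖ ^ 2 := fun x =>
      (hK x).trans (mul_le_mul_of_nonneg_right (le_abs_self K) (by positivity))
    have h1 := hK' (a + b)
    have h2 := hK' a
    have h3 := hK' b
    rw [hb] at h3
    have h4 : |K| * ‖a + b‖ ^ 2 ≤ |K| * (‖a‖ + 1) ^ 2 := by
      gcongr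
      simpa [hb] using norm_add_le a b
    have h5 := norm_sub_le (G (a + b) - G a) (G b)
    have h6 := norm_sub_le (G (a + b)) (G a)
    simp only [QuadraticMap.polar]
    linarith
  set M := |K| * (‖a‖ + 1) ^ 2 + |K| * ‖a‖ ^ 2 + |K|
  refine AddMonoidHomClass.continuous_of_bound (hG.form a) M fun b => ?_
  by_cases hb : b = 0
  · simp [hb]
  have hb' : ‖b‖ ≠ 0 := norm_ne_zero_iff.2 hb
  set u : H := ((‖b‖ : ℂ)⁻¹) • b
  have hu : ‖u‖ = 1 := by simp [u, norm_smul, hb']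
  have e : b = (‖b‖ : ℂ) • u := by
    rw [smul_inv_smul₀]
    exact_mod_cast hb'
  have hle : ‖hG.form a u‖ ≤ M := by
    rw [form_apply, norm_smul]
    have h1 := hpol u hu
    have h2 := hpol (Complex.I • u) (by rw [norm_smul, Complex.norm_I, hu, one_mul])
    have h3 := norm_sub_le (QuadraticMap.polar G a u)
      (Complex.I • QuadraticMap.polar G a (Complex.I • u))
    rw [norm_smul, Complex.norm_I, one_mul] at h3
    norm_num
    linarith
  rw [e, map_smul, norm_smul, norm_smul, hu, mul_one, mul_comm]
  gcongr

end IsRealQuadratic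

/-! ### Quadratic extension of the phase densities -/

noncomputable section

/-- The unit vector in the direction of `a`. -/
def unitDir (a : Hardy) : Hardy := ((‖a‖ : ℂ)⁻¹) • a

theorem norm_unitDir {a : Hardy} (ha : a ≠ 0) : ‖unitDir a‖ = 1 := by
  have : ‖a‖ ≠ 0 := norm_ne_zero_iff.2 ha
  rw [unitDir, norm_smul, norm_inv, Complex.norm_real, norm_norm, inv_mul_cancel₀ this]

theorem norm_smul_unitDir (a : Hardy) : (‖a‖ : ℂ) • unitDir a = a := by
  by_cases ha : a = 0
  · simp [ha]
  · exact smul_inv_smul₀ (by exact_mod_cast norm_ne_zero_iff.2 ha) a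

namespace IsPhaseObservable

variable {f : Hardy → Hardy → PhaseCircle → ℂ}

open Classical in
/-- The densities `f_{ψ,ψ}`, extended quadratically from unit vectors to all of `H²`. -/
def density (hf : IsPhaseObservable f) (a : Hardy) : PhaseCircle →₁[volume] ℂ :=
  if h : a = 0 then 0 else
    ((‖a‖ : ℂ) ^ 2) • (hf.integrable (unitDir a) (norm_unitDir h)).toL1 _

theorem density_zero (hf : IsPhaseObservable f) : hf.density 0 = 0 := by simp [density]

theorem density_ae (hf : IsPhaseObservable f) {a : Hardy} (ha : a ≠ 0) :
    hf.density a =ᵐ[volume] fun θ => (‖a‖ : ℂ) ^ 2 * f (unitDir a) (unitDir a) θ := by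
  rw [density, dif_neg ha]
  filter_upwards [Lp.coeFn_smul ((‖a‖ : ℂ) ^ 2)
    ((hf.integrable (unitDir a) (norm_unitDir ha)).toL1 _),
    (hf.integrable (unitDir a) (norm_unitDir ha)).coeFn_toL1] with θ h1 h2
  rw [h1, Pi.smul_apply, h2, smul_eq_mul]

theorem density_ae_of_norm_eq_one (hf : IsPhaseObservable f) {a : Hardy} (ha : ‖a‖ = 1) :
    hf.density a =ᵐ[volume] f a a := by
  have h0 : a ≠ 0 := by rintro rfl; simp at ha
  have hu : unitDir a = a := by simp [unitDir, ha]
  filter_upwards [hf.density_ae h0] with θ h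
  rw [h, hu, ha]
  simp

theorem density_nonneg (hf : IsPhaseObservable f) (a : Hardy) :
    ∀ᵐ θ ∂volume, (hf.density a θ).im = 0 ∧ 0 ≤ (hf.density a θ).re := by
  by_cases ha : a = 0
  · rw [ha, density_zero]
    filter_upwards [Lp.coeFn_zero ℂ 1 (volume : Measure PhaseCircle)] with θ h
    rw [h]
    simp
  · filter_upwards [hf.density_ae ha, hf.nonneg _ (norm_unitDir ha)] with θ h1 h2
    rw [h1, ← Complex.ofReal_pow, Complex.im_ofReal_mul, Complex.re_ofReal_mul, h2.1]
    exact ⟨mul_zero _, mul_nonneg (by positivity) h2.2⟩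

theorem norm_density (hf : IsPhaseObservable f) (a : Hardy) :
    ‖hf.density a‖ = 2 * π * ‖a‖ ^ 2 := by
  by_cases ha : a = 0
  · simp [ha, density_zero]
  · rw [L1.norm_eq_integral_norm]
    have h : (fun θ => ‖hf.density a θ‖) =ᵐ[volume]
        fun θ => ‖a‖ ^ 2 * (f (unitDir a) (unitDir a) θ).re := by
      filter_upwards [hf.density_ae ha, hf.nonneg _ (norm_unitDir ha)] with θ h1 h2
      have e : f (unitDir a) (unitDir a) θ = ((f (unitDir a) (unitDir a) θ).re : ℂ) :=
        Complex.ext rfl (by simpa using h2.1)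
      rw [h1, e, norm_mul, Complex.norm_real, Real.norm_of_nonneg h2.2, norm_pow,
        Complex.norm_real, norm_norm, Complex.ofReal_re]
    have h1 := hf.normalized _ (norm_unitDir ha)
    rw [integral_congr_ae h, integral_const_mul]
    have hpi := Real.pi_pos
    field_simp at h1
    rw [h1]
    ring

theorem density_smul (hf : IsPhaseObservable f) (c : ℂ) (a : Hardy) :
    hf.density (c • a) = ((‖c‖ : ℂ) ^ 2) • hf.density a := by
  by_cases hc : c = 0
  · simp [hc, density_zero]
  by_cases ha : a = 0
  · simp [ha, density_zero]
  have hc' : (‖c‖ : ℂ) ≠ 0 := by exact_mod_cast norm_ne_zero_iff.2 hc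
  -- Phase invariance is the interference condition with second coefficient zero.
  have hu : unitDir (c • a) = (c * (‖c‖ : ℂ)⁻¹) • unitDir a + (0 : ℂ) • unitDir a := by
    rw [unitDir, unitDir, norm_smul, smul_smul, smul_smul, zero_smul, add_zero]
    congr 1
    push_cast
    rw [mul_inv]
    ring
  have hn : ‖c * (‖c‖ : ℂ)⁻¹‖ = 1 := by
    rw [norm_mul, norm_inv, Complex.norm_real, norm_norm,
      mul_inv_cancel₀ (norm_ne_zero_iff.2 hc)]
  have h0 := norm_unitDir (smul_ne_zero hc ha)
  rw [hu] at h0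
  refine Lp.ext ?_
  filter_upwards [hf.density_ae (smul_ne_zero hc ha), hf.density_ae ha,
    Lp.coeFn_smul ((‖c‖ : ℂ) ^ 2) (hf.density a),
    hf.interference _ _ (norm_unitDir ha) (norm_unitDir ha) _ _ h0] with θ h1 h2 h3 h4
  rw [h1, h3, Pi.smul_apply, h2, hu, h4, hn, norm_smul, smul_eq_mul]
  push_cast
  simp
  ring

/-- The bracket multiplying `t` does not depend on `t`, so the case `t = 1` identifies it with the
polar. -/
theorem density_add_smul_ae (hf : IsPhaseObservable f) {a b : Hardy} (ha : a ≠ 0) (hb : b ≠ 0)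
    (t : ℝ) (hab : a + (t : ℂ) • b ≠ 0) :
    hf.density (a + (t : ℂ) • b) =ᵐ[volume] fun θ =>
      hf.density a θ + (t : ℂ) ^ 2 * hf.density b θ + (t : ℂ) * ((‖a‖ : ℂ) * (‖b‖ : ℂ) *
        (f (unitDir a) (unitDir b) θ + f (unitDir b) (unitDir a) θ)) := by
  set n := ‖a + (t : ℂ) • b‖ with hn
  have hn0 : n ≠ 0 := norm_ne_zero_iff.2 hab
  have hn0' : (n : ℂ) ≠ 0 := by exact_mod_cast hn0
  have hu : unitDir (a + (t : ℂ) • b) = ((n⁻¹ * ‖a‖ : ℝ) : ℂ) • unitDir a +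
      ((n⁻¹ * t * ‖b‖ : ℝ) : ℂ) • unitDir b := by
    conv_lhs => rw [unitDir, ← hn, smul_add, smul_smul]
    conv_lhs => rw [← norm_smul_unitDir a, ← norm_smul_unitDir b, smul_smul, smul_smul]
    push_cast
    rfl
  have h0 := norm_unitDir hab
  rw [hu] at h0
  have hsq : ∀ r : ℝ, (‖(r : ℂ)‖ : ℂ) ^ 2 = (r : ℂ) ^ 2 := by
    intro r
    rw [Complex.norm_real, ← Complex.ofReal_pow, Real.norm_eq_abs, sq_abs, Complex.ofReal_pow]
  filter_upwards [hf.density_ae hab, hf.density_ae ha, hf.density_ae hb,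
    hf.interference _ _ (norm_unitDir ha) (norm_unitDir hb) _ _ h0] with θ h1 h2 h3 h4
  rw [h1, h2, h3, hu, h4, ← hn, hsq, hsq]
  simp only [Complex.star_def, Complex.conj_ofReal]
  push_cast
  field_simp
  ring

theorem isRealQuadratic_density (hf : IsPhaseObservable f) : IsRealQuadratic hf.density where
  smul := hf.density_smul
  line t a b := by
    have hsq : ∀ r : ℝ, (‖(r : ℂ)‖ : ℂ) ^ 2 = (r : ℂ) ^ 2 := by
      intro r
      rw [Complex.norm_real, ← Complex.ofReal_pow, Real.norm_eq_abs, sq_abs, Complex.ofReal_pow]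
    by_cases hb : b = 0
    · simp [hb, density_zero, QuadraticMap.polar]
    -- For real multiples some `a + s • b` vanishes and has no unit direction; homogeneity settles
    -- this case.
    by_cases hr : ∃ r : ℝ, a = (r : ℂ) • b
    · obtain ⟨r, rfl⟩ := hr
      have e1 : (r : ℂ) • b + (t : ℂ) • b = ((r + t : ℝ) : ℂ) • b := by push_cast; module
      have e2 : (r : ℂ) • b + b = ((r + 1 : ℝ) : ℂ) • b := by push_cast; module
      rw [QuadraticMap.polar, e1, e2, density_smul, density_smul, density_smul, hsq, hsq, hsq]
      push_cast
      module
    · push Not at hr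
      have ha : a ≠ 0 := by simpa using hr 0
      have hne : ∀ s : ℝ, a + (s : ℂ) • b ≠ 0 := by
        intro s hs
        refine hr (-s) ?_
        push_cast
        rw [neg_smul]
        exact eq_neg_of_add_eq_zero_left hs
      have h1 := hf.density_add_smul_ae ha hb t (hne t)
      have h2 := hf.density_add_smul_ae ha hb 1 (hne 1)
      rw [Complex.ofReal_one, one_smul] at h2
      refine Lp.ext ?_
      rw [QuadraticMap.polar]
      filter_upwards [h1, h2,
        Lp.coeFn_add (hf.density a + ((t : ℂ) ^ 2) • hf.density b)
          ((t : ℂ) • (hf.density (a + b) - hf.density a - hf.density b)),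
        Lp.coeFn_add (hf.density a) (((t : ℂ) ^ 2) • hf.density b),
        Lp.coeFn_smul ((t : ℂ) ^ 2) (hf.density b),
        Lp.coeFn_smul (t : ℂ) (hf.density (a + b) - hf.density a - hf.density b),
        Lp.coeFn_sub (hf.density (a + b) - hf.density a) (hf.density b),
        Lp.coeFn_sub (hf.density (a + b)) (hf.density a)] with θ g1 g2 g3 g4 g5 g6 g7 g8
      rw [g3, Pi.add_apply, g4, Pi.add_apply, g5, g6, Pi.smul_apply, Pi.smul_apply, g7,
        Pi.sub_apply, g8, Pi.sub_apply, g1, g2, smul_eq_mul, smul_eq_mul]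
      ring

/-- Where the density of `b` vanishes, so do its interference terms. -/
theorem polar_density_eq_zero (hf : IsPhaseObservable f) (a b : Hardy) :
    ∀ᵐ θ ∂volume, hf.density b θ = 0 → QuadraticMap.polar hf.density a b θ = 0 := by
  -- Integer parameters allow a single null set. Where the density of `b` vanishes, an affine
  -- function of `k` stays nonnegative on all of `ℤ`, so its slope is zero.
  have hline : ∀ k : ℤ, ∀ᵐ θ ∂volume, hf.density (a + ((k : ℝ) : ℂ) • b) θ =
      hf.density a θ + ((k : ℝ) : ℂ) ^ 2 * hf.density b θ
        + ((k : ℝ) : ℂ) * QuadraticMap.polar hf.density a b θ := by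
    intro k
    rw [hf.isRealQuadratic_density.line]
    filter_upwards [Lp.coeFn_add (hf.density a + (((k : ℝ) : ℂ) ^ 2) • hf.density b)
          (((k : ℝ) : ℂ) • QuadraticMap.polar hf.density a b),
        Lp.coeFn_add (hf.density a) ((((k : ℝ) : ℂ) ^ 2) • hf.density b),
        Lp.coeFn_smul (((k : ℝ) : ℂ) ^ 2) (hf.density b),
        Lp.coeFn_smul ((k : ℝ) : ℂ) (QuadraticMap.polar hf.density a b)] with θ g3 g4 g5 g6
    rw [g3, Pi.add_apply, g4, Pi.add_apply, g5, g6, Pi.smul_apply, Pi.smul_apply, smul_eq_mul,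
      smul_eq_mul]
  filter_upwards [ae_all_iff.2 hline, hf.density_nonneg a,
    ae_all_iff.2 fun k : ℤ => hf.density_nonneg (a + ((k : ℝ) : ℂ) • b)] with θ h1 h2 h3 hb
  have h4 : ∀ k : ℤ, 0 ≤ (hf.density a θ).re
      + k * (QuadraticMap.polar hf.density a b θ).re := by
    intro k
    have := (h3 k).2
    rw [h1, hb] at this
    simpa [Complex.re_ofReal_mul] using this
  have h5 : (QuadraticMap.polar hf.density a b θ).im = 0 := by
    have := (h3 1).1
    rw [h1, hb] at this
    simpa [h2.1] using this
  set x := (hf.density a θ).re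
  have h6 : (QuadraticMap.polar hf.density a b θ).re = 0 := by
    set y := (QuadraticMap.polar hf.density a b θ).re
    by_contra hy
    obtain ⟨k, hk⟩ := exists_int_lt (-x / |y| - 1)
    have hy' : 0 < |y| := abs_pos.2 hy
    have hk1 : (k : ℝ) * |y| < -x := by
      rw [← lt_div_iff₀ hy']
      linarith
    rcases abs_cases y with ⟨e, _⟩ | ⟨e, _⟩
    · rw [e] at hk1
      linarith [h4 k]
    · rw [e] at hk1
      have := h4 (-k)
      push_cast at this
      linarith
  exact Complex.ext h6 h5

theorem form_density_eq_zero (hf : IsPhaseObservable f) (a b : Hardy) :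
    ∀ᵐ θ ∂volume, hf.density b θ = 0 → hf.isRealQuadratic_density.form a b θ = 0 := by
  have hI : hf.density (Complex.I • b) = hf.density b := by simp [density_smul]
  rw [IsRealQuadratic.form_apply]
  filter_upwards [hf.polar_density_eq_zero a b, hf.polar_density_eq_zero a (Complex.I • b),
    Lp.coeFn_smul (1 / 2 : ℂ) (QuadraticMap.polar hf.density a b
      - Complex.I • QuadraticMap.polar hf.density a (Complex.I • b)),
    Lp.coeFn_sub (QuadraticMap.polar hf.density a b)
      (Complex.I • QuadraticMap.polar hf.density a (Complex.I • b)),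
    Lp.coeFn_smul Complex.I (QuadraticMap.polar hf.density a (Complex.I • b))]
    with θ h1 h2 h3 h4 h5 hb
  rw [hI] at h2
  rw [h3, Pi.smul_apply, h4, Pi.sub_apply, h5, Pi.smul_apply, h1 hb, h2 hb]
  simp

end IsPhaseObservable

/-! ### Phase shifts and number states -/

theorem phaseShift_add (α : ℝ) (a b : Hardy) :
    phaseShift α (a + b) = phaseShift α a + phaseShift α b :=
  Subtype.ext (map_add (Lp.compMeasurePreserving (fun θ : PhaseCircle => θ + (α : PhaseCircle))
    (measurePreserving_add_right AddCircle.haarAddCircle _)) (a : PhaseL2) b)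

theorem phaseShift_smul (α : ℝ) (c : ℂ) (a : Hardy) :
    phaseShift α (c • a) = c • phaseShift α a :=
  Subtype.ext (map_smul (Lp.compMeasurePreservingₗ ℂ
    (fun θ : PhaseCircle => θ + (α : PhaseCircle))
    (measurePreserving_add_right AddCircle.haarAddCircle _)) c (a : PhaseL2))

theorem norm_phaseShift (α : ℝ) (a : Hardy) : ‖phaseShift α a‖ = ‖a‖ :=
  Lp.norm_compMeasurePreserving (a : PhaseL2)
    (measurePreserving_add_right AddCircle.haarAddCircle (α : PhaseCircle))

theorem phaseShift_unitDir (α : ℝ) (a : Hardy) :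
    unitDir (phaseShift α a) = phaseShift α (unitDir a) := by
  rw [unitDir, unitDir, phaseShift_smul, norm_phaseShift]

/-- The number state `e^{-inθ}`. -/
def numberState (n : ℕ) : Hardy := ⟨fourierLp 2 (-(n : ℤ)), fun k hk => by
  rw [fourierCoeff_toLp, fourierCoeff_fourier, Pi.single_eq_of_ne (by lia)]⟩

theorem norm_numberState (n : ℕ) : ‖numberState n‖ = 1 :=
  orthonormal_fourier.1 (-(n : ℤ))

theorem phaseShift_numberState (α : ℝ) (n : ℕ) :
    phaseShift α (numberState n) = (fourier (-(n : ℤ)) (α : PhaseCircle) : ℂ) • numberState n := by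
  refine Subtype.ext (Lp.ext ?_)
  have h1 := shiftL2_ae α (fourierLp (T := 2 * π) 2 (-(n : ℤ)))
  have h2 := (measurePreserving_add_right AddCircle.haarAddCircle
    (α : PhaseCircle)).quasiMeasurePreserving.ae_eq_comp (coeFn_fourierLp (T := 2 * π) 2 (-(n : ℤ)))
  have h3 := Lp.coeFn_smul (fourier (-(n : ℤ)) (α : PhaseCircle) : ℂ) (fourierLp (T := 2 * π) 2 (-(n : ℤ)))
  filter_upwards [h1, h2, h3, coeFn_fourierLp (T := 2 * π) 2 (-(n : ℤ))] with θ g1 g2 g3 g4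
  refine g1.trans (Eq.trans ?_ g3.symm)
  refine Eq.trans g2 ?_
  rw [Pi.smul_apply, g4, Function.comp_apply, smul_eq_mul]
  simp [fourier_apply, smul_add, AddCircle.toCircle_add, mul_comm]

theorem hasSum_numberState (a : Hardy) :
    HasSum (fun n : ℕ => fourierCoeff ((a : PhaseL2) : PhaseCircle → ℂ) (-(n : ℤ)) •
      numberState n) a := by
  have h := hasSum_fourier_series_L2 (a : PhaseL2)
  have hinj : Function.Injective fun n : ℕ => -(n : ℤ) := fun m n h => by simpa using h
  rw [← hinj.hasSum_iff] at h
  · exact (Topology.IsInducing.hasSum_iff (g := Submodule.subtype Hardy)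
      Topology.IsInducing.subtypeVal (fun n : ℕ => fourierCoeff ((a : PhaseL2) : PhaseCircle → ℂ) (-(n : ℤ)) •
      numberState n) a).1 h
  · intro k hk
    have hk' : 0 < k := by
      by_contra hle
      exact hk ⟨k.natAbs, by simp only; lia⟩
    rw [a.2 k hk', zero_smul]

/-- One radian is an irrational fraction `1 / (2π)` of the full turn. One ergodic shift replaces the
uncountable family of covariance conditions. -/
theorem ergodic_add_one : Ergodic (fun θ : PhaseCircle => θ + ((1 : ℝ) : PhaseCircle)) volume := by
  rw [AddCircle.ergodic_add_right, ← AddCircle.denseRange_zsmul_iff,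
    AddCircle.denseRange_zsmul_coe_iff]
  rw [one_div]
  exact_mod_cast (irrational_pi.natCast_mul (m := 2) (by norm_num)).inv

/-! ### Covariance and almost everywhere positivity -/

namespace IsPhaseObservable

variable {f : Hardy → Hardy → PhaseCircle → ℂ}

/-- Translation by `α` on `L¹` of the phase circle. -/
def shiftL1 (α : ℝ) : (PhaseCircle →₁[volume] ℂ) →ₗ[ℂ] (PhaseCircle →₁[volume] ℂ) :=
  Lp.compMeasurePreservingₗ ℂ (fun θ : PhaseCircle => θ + (α : PhaseCircle))
    (measurePreserving_add_right _ _)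

theorem shiftL1_ae (α : ℝ) (k : PhaseCircle →₁[volume] ℂ) :
    shiftL1 α k =ᵐ[volume] fun θ => k (θ + (α : PhaseCircle)) :=
  Lp.coeFn_compMeasurePreserving k (measurePreserving_add_right _ _)

theorem density_phaseShift (hf : IsPhaseObservable f) (α : ℝ) (a : Hardy) :
    hf.density (phaseShift α a) = shiftL1 α (hf.density a) := by
  by_cases ha : a = 0
  · have h0 : phaseShift α (0 : Hardy) = 0 := by
      rw [← norm_eq_zero, norm_phaseShift, norm_zero]
    rw [ha, h0, density_zero, map_zero]
  have ha' : phaseShift α a ≠ 0 := by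
    rwa [← norm_ne_zero_iff, norm_phaseShift, norm_ne_zero_iff]
  refine Lp.ext ?_
  filter_upwards [hf.density_ae ha', shiftL1_ae α (hf.density a),
    (measurePreserving_add_right volume (α : PhaseCircle)).quasiMeasurePreserving.ae_eq_comp
      (hf.density_ae ha), hf.covariant _ (norm_unitDir ha) α] with θ h1 h2 h3 h4
  rw [h1, h2, phaseShift_unitDir, h4, norm_phaseShift]
  exact h3.symm

theorem form_phaseShift (hf : IsPhaseObservable f) (α : ℝ) (a b : Hardy) :
    hf.isRealQuadratic_density.form (phaseShift α a) (phaseShift α b) =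
      shiftL1 α (hf.isRealQuadratic_density.form a b) := by
  simp only [IsRealQuadratic.form_apply, QuadraticMap.polar, ← phaseShift_smul, ← phaseShift_add,
    density_phaseShift, map_smul, map_sub]

/-- The interference term of two number states is a multiple of a Fourier monomial. -/
theorem exists_form_numberState (hf : IsPhaseObservable f) (n m : ℕ) : ∃ C : ℂ,
    hf.isRealQuadratic_density.form (numberState n) (numberState m) =
      C • ContinuousMap.toLp 1 volume ℂ (fourier ((n : ℤ) - m) : C(PhaseCircle, ℂ)) := by
  set k := hf.isRealQuadratic_density.form (numberState n) (numberState m)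
  have hk : shiftL1 1 k = (fourier ((n : ℤ) - m) ((1 : ℝ) : PhaseCircle) : ℂ) • k := by
    rw [← form_phaseShift, phaseShift_numberState, phaseShift_numberState,
      IsRealQuadratic.form_smul_smul]
    · rw [Complex.star_def, ← fourier_neg, neg_neg, ← fourier_add, ← sub_eq_add_neg]
    · rw [fourier_apply, Circle.norm_coe]
  -- Multiplying by the inverse character makes `k` invariant under the rotation, hence constant.
  obtain ⟨C, hC⟩ := ergodic_add_one.ae_eq_const_of_ae_eq_comp_ae
    (g := fun θ : PhaseCircle => fourier ((m : ℤ) - n) θ * k θ)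
    ((map_continuous (fourier ((m : ℤ) - n))).aestronglyMeasurable.mul
      (Lp.aestronglyMeasurable k)) (by
    have h1 := shiftL1_ae 1 k
    rw [hk] at h1
    filter_upwards [h1, Lp.coeFn_smul (fourier ((n : ℤ) - m) ((1 : ℝ) : PhaseCircle) : ℂ) k]
      with θ h1 h2
    rw [h2, Pi.smul_apply, smul_eq_mul] at h1
    rw [Function.comp_apply, ← h1]
    have e1 : (fourier ((m : ℤ) - n) (θ + ((1 : ℝ) : PhaseCircle)) : ℂ) =
        fourier ((m : ℤ) - n) θ * fourier ((m : ℤ) - n) ((1 : ℝ) : PhaseCircle) := by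
      simp only [fourier_apply, smul_add, AddCircle.toCircle_add, Circle.coe_mul]
    have e2 : (fourier ((m : ℤ) - n) ((1 : ℝ) : PhaseCircle) : ℂ) *
        fourier ((n : ℤ) - m) ((1 : ℝ) : PhaseCircle) = 1 := by
      rw [← fourier_add]
      simp
    rw [e1]
    linear_combination (fourier ((m : ℤ) - n) θ : ℂ) * k θ * e2)
  refine ⟨C, Lp.ext ?_⟩
  filter_upwards [hC, Lp.coeFn_smul C (ContinuousMap.toLp 1 (volume : Measure PhaseCircle) ℂ
      (fourier ((n : ℤ) - m) : C(PhaseCircle, ℂ))),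
    ContinuousMap.coeFn_toLp (𝕜 := ℂ) (p := 1) (volume : Measure PhaseCircle)
      (fourier ((n : ℤ) - m) : C(PhaseCircle, ℂ))]
    with θ h1 h2 h3
  rw [h2, Pi.smul_apply, h3, smul_eq_mul]
  simp only [Function.const_apply] at h1
  rw [← h1]
  have e2 : (fourier ((m : ℤ) - n) θ : ℂ) * fourier ((n : ℤ) - m) θ = 1 := by
    rw [← fourier_add]
    simp
  linear_combination (-k θ) * e2

open Filter Topology in
/-- The density of a nonzero state is almost everywhere nonzero. -/
theorem density_ae_ne_zero (hf : IsPhaseObservable f) {a : Hardy} (ha : a ≠ 0) :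
    ∀ᵐ θ ∂volume, hf.density a θ ≠ 0 := by
  classical
  set d : ℕ → ℂ := fun n => fourierCoeff ((a : PhaseL2) : PhaseCircle → ℂ) (-(n : ℤ)) with hd
  have hsum : HasSum (fun n => d n • numberState n) a := hasSum_numberState a
  have hex : ∃ n, d n ≠ 0 := by
    by_contra! h
    simp only [h, zero_smul] at hsum
    exact ha (hsum.unique hasSum_zero)
  set n := Nat.find hex
  have hdn : d n ≠ 0 := Nat.find_spec hex
  have hlt : ∀ m < n, d m = 0 := fun m hm => by simpa using Nat.find_min hex hm
  have hinj : Function.Injective fun m : ℕ => n + m := add_right_injective n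
  rw [← hinj.hasSum_iff] at hsum
  swap
  · intro m hm
    rw [hlt m, zero_smul]
    by_contra hle
    exact hm ⟨m - n, by simp only; lia⟩
  have hcont : Continuous (hf.isRealQuadratic_density.form (numberState n)) :=
    hf.isRealQuadratic_density.continuous_form (K := 2 * π)
      (fun b => (hf.norm_density b).le) _
  set h := hf.isRealQuadratic_density.form (numberState n) a
  choose C hC using fun m : ℕ => hf.exists_form_numberState n (n + m)
  -- `C 0` is the constant density of the number state `n`, whose norm is `2π`.
  have hC0 : C 0 ≠ 0 := by
    intro h0
    have h1 := hC 0
    rw [add_zero, h0, zero_smul, IsRealQuadratic.form_self] at h1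
    have h2 := hf.norm_density (numberState n)
    rw [h1, norm_numberState, norm_zero] at h2
    linarith [Real.pi_pos]
  -- The index shift makes every partial sum contain the constant term. Conjugation in `p` turns
  -- `e^{-imθ}` into powers of `e^{iθ}`.
  have hlim := ((hcont.tendsto a).comp hsum.tendsto_sum_nat).comp (tendsto_add_atTop_nat 1)
  set p : ℕ → Polynomial ℂ := fun N => ∑ m ∈ Finset.range (N + 1),
    Polynomial.monomial m (star (d (n + m) * C m)) with hp
  have hform : ∀ N, hf.isRealQuadratic_density.form (numberState n)
      (∑ m ∈ Finset.range (N + 1), d (n + m) • numberState (n + m)) =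
      ContinuousMap.toLp 1 volume ℂ (∑ m ∈ Finset.range (N + 1), (d (n + m) * C m) •
        (fourier (-(m : ℤ)) : C(PhaseCircle, ℂ))) := by
    intro N
    rw [map_sum, map_sum]
    refine Finset.sum_congr rfl fun m _ => ?_
    rw [map_smul, map_smul, hC, smul_smul]
    congr 4
    push_cast
    ring
  have hev : ∀ N (θ : PhaseCircle), (p N).eval (θ.toCircle : ℂ) =
      star ((∑ m ∈ Finset.range (N + 1), (d (n + m) * C m) •
        (fourier (-(m : ℤ)) : C(PhaseCircle, ℂ))) θ) := by
    intro N θ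
    rw [hp, Polynomial.eval_finsetSum, ContinuousMap.sum_apply, star_sum]
    refine Finset.sum_congr rfl fun m _ => ?_
    rw [Polynomial.eval_monomial, ContinuousMap.smul_apply, smul_eq_mul, star_mul' _ (fourier _ θ), fourier_neg,
      Complex.star_def, Complex.conj_conj, fourier_apply,
      AddCircle.toCircle_zsmul]
    simp
  have hne := ae_ne_zero_of_tendsto_polynomial (h := fun θ => star (h θ))
    ((L1.integrable_coeFn h).congr'
      (continuous_star.comp_aestronglyMeasurable (Lp.aestronglyMeasurable h)) (by simp)) p (c := star (d n * C 0))
    (star_ne_zero.2 (mul_ne_zero hdn hC0)) (fun N => by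
      simp [hp, Polynomial.coeff_monomial]) (by
      rw [tendsto_iff_norm_sub_tendsto_zero] at hlim
      refine hlim.congr fun N => ?_
      rw [L1.norm_eq_integral_norm]
      simp only [Function.comp_apply]
      rw [hform]
      refine integral_congr_ae ?_
      filter_upwards [Lp.coeFn_sub (ContinuousMap.toLp 1 volume ℂ (∑ m ∈ Finset.range (N + 1),
          (d (n + m) * C m) • (fourier (-(m : ℤ)) : C(PhaseCircle, ℂ)))) h,
        ContinuousMap.coeFn_toLp (𝕜 := ℂ) (p := 1) (volume : Measure PhaseCircle)
          (∑ m ∈ Finset.range (N + 1),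
          (d (n + m) * C m) • (fourier (-(m : ℤ)) : C(PhaseCircle, ℂ)))] with θ h1 h2
      rw [h1, Pi.sub_apply, h2, hev, ← star_sub, norm_star])
  filter_upwards [hne, hf.form_density_eq_zero (numberState n) a] with θ h1 h2 h3
  exact h1 (by rw [h2 h3, star_zero])

/-- In every vector state the phase density is almost everywhere positive on `[0, 2π)`. -/
theorem ae_re_pos (hf : IsPhaseObservable f) {a : Hardy} (ha : ‖a‖ = 1) :
    ∀ᵐ θ : ℝ ∂volume.restrict (Ico 0 (2 * π)), 0 < (f a a (θ : PhaseCircle)).re := by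
  have h0 : a ≠ 0 := by rintro rfl; simp at ha
  have h : ∀ᵐ θ ∂volume, 0 < (f a a θ).re := by
    filter_upwards [hf.density_ae_ne_zero h0, hf.density_ae_of_norm_eq_one ha, hf.nonneg a ha]
      with θ h1 h2 h3
    rw [h2] at h1
    exact h3.2.lt_of_ne fun h4 => h1 (Complex.ext h4.symm h3.1)
  have h1 := (AddCircle.measurePreserving_mk (2 * π) 0).quasiMeasurePreserving.ae h
  rw [zero_add] at h1
  rwa [restrict_Ico_eq_restrict_Ioc]

/-! ### Probabilities of Borel sets -/

theorem integrableOn_Ico (hf : IsPhaseObservable f) {a : Hardy} (ha : ‖a‖ = 1) :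
    IntegrableOn (fun θ : ℝ => (f a a (θ : PhaseCircle)).re) (Ico 0 (2 * π)) := by
  have h1 := (AddCircle.measurePreserving_mk (2 * π) 0).integrable_comp_of_integrable
    (hf.integrable a ha).re
  rw [zero_add] at h1
  rw [IntegrableOn, restrict_Ico_eq_restrict_Ioc]
  exact h1

theorem integral_Ico (hf : IsPhaseObservable f) {a : Hardy} (ha : ‖a‖ = 1) :
    ∫ θ in Ico 0 (2 * π), (f a a (θ : PhaseCircle)).re = 2 * π := by
  have h1 := hf.normalized a ha
  have hpi := Real.pi_pos
  rw [← AddCircle.integral_preimage (2 * π) 0, zero_add] at h1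
  rw [integral_Ico_eq_integral_Ioc]
  field_simp at h1
  exact h1

/-- Sets of positive measure have positive probability. -/
theorem setIntegral_pos (hf : IsPhaseObservable f) {a : Hardy} (ha : ‖a‖ = 1) {X : Set ℝ}
    (hX : X ⊆ Ico 0 (2 * π)) (hX0 : volume X ≠ 0) :
    0 < ∫ θ in X, (f a a (θ : PhaseCircle)).re := by
  have hpos := ae_restrict_of_ae_restrict_of_subset hX (hf.ae_re_pos ha)
  rw [integral_pos_iff_support_of_nonneg_ae (hpos.mono fun _ h => h.le)
    ((hf.integrableOn_Ico ha).mono_set hX)]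
  have : (Function.support fun θ : ℝ => (f a a (θ : PhaseCircle)).re) =ᵐ[volume.restrict X]
      univ := by
    filter_upwards [hpos] with θ h
    exact eq_true h.ne'
  rw [measure_congr this, Measure.restrict_apply_univ]
  exact pos_iff_ne_zero.2 hX0

/-- Sets that are not of full measure have probability less than one. -/
theorem setIntegral_lt (hf : IsPhaseObservable f) {a : Hardy} (ha : ‖a‖ = 1) {X : Set ℝ}
    (hX : X ⊆ Ico 0 (2 * π)) (hXm : MeasurableSet X)
    (hlt : volume X < ENNReal.ofReal (2 * π)) :
    (2 * π)⁻¹ * ∫ θ in X, (f a a (θ : PhaseCircle)).re < 1 := by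
  have hd : volume (Ico 0 (2 * π) \ X) ≠ 0 := by
    intro h0
    have h1 := measure_le_inter_add_sdiff volume (Ico 0 (2 * π)) X
    rw [h0, add_zero, inter_eq_self_of_subset_right hX, Real.volume_Ico, sub_zero] at h1
    exact absurd hlt h1.not_gt
  have h1 := hf.setIntegral_pos ha sdiff_subset hd
  rw [setIntegral_sdiff hXm (hf.integrableOn_Ico ha) hX, hf.integral_Ico ha] at h1
  rw [inv_mul_lt_one₀ Real.two_pi_pos]
  linarith

end IsPhaseObservable

end

theorem theorem1 (f : Hardy → Hardy → PhaseCircle → ℂ) (hf : IsPhaseObservable f) :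
    (∀ X : Set ℝ, X ⊆ Ico 0 (2 * π) → MeasurableSet X → volume X < ENNReal.ofReal (2 * π) →
      ∀ ψ : Hardy, ‖ψ‖ = 1 →
        (2 * π)⁻¹ * ∫ θ in X, (f ψ ψ (θ : PhaseCircle)).re < 1) ∧
    ProbabilisticallyComplementary (phaseProb f) numberProb := by
  refine ⟨fun X hX hXm hlt ψ hψ => hf.setIntegral_lt hψ hX hXm hlt, ?_⟩
  rintro X S hXm - ⟨⟨φ₀, -, h0⟩, ⟨φ₁, hφ₁, h1⟩⟩ - ψ hψ
  have hsub : X ∩ Ico 0 (2 * π) ⊆ Ico 0 (2 * π) := inter_subset_right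
  -- Null sets and sets of full measure give constant probabilities `0` and `1`, so nontriviality
  -- puts the measure strictly between `0` and `2π`.
  have hX0 : volume (X ∩ Ico 0 (2 * π)) ≠ 0 := by
    intro h
    exact h0 (by rw [phaseProb, setIntegral_measure_zero _ h, mul_zero])
  have hX1 : volume (X ∩ Ico 0 (2 * π)) < ENNReal.ofReal (2 * π) := by
    have hI : volume (Ico 0 (2 * π)) = ENNReal.ofReal (2 * π) := by
      rw [Real.volume_Ico, sub_zero]
    refine lt_of_le_of_ne (hI ▸ measure_mono hsub) fun h => h1 ?_
    have hae := ae_eq_of_subset_of_measure_ge hsub (hI.trans h.symm).le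
      (hXm.inter measurableSet_Ico).nullMeasurableSet (by rw [hI]; exact ENNReal.ofReal_ne_top)
    rw [phaseProb, setIntegral_congr_set hae, hf.integral_Ico hφ₁,
      inv_mul_cancel₀ Real.two_pi_pos.ne']
  have hlt : phaseProb f ψ X < 1 :=
    hf.setIntegral_lt hψ hsub (hXm.inter measurableSet_Ico) hX1
  have hpos : 0 < phaseProb f ψ X :=
    mul_pos (inv_pos.2 Real.two_pi_pos) (hf.setIntegral_pos hψ hsub hX0)
  -- The phase probability is never `1`, so the first implication is vacuous; the second holds in
  -- every state.
  exact ⟨fun h => absurd h hlt.ne, fun _ => ⟨hpos, hlt⟩⟩
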